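/- Let $I$ be a totally ordered set. For each $i\in I$ let $\mathcal A_i$ be a complex $*$-algebra (not necessarily unital) with two states $\varphi_i,\psi_i$, let $\mathcal H_i$ be a complex Hilbert space with a unit vector $\xi_i$, and let $\pi_i,\sigma_i:\mathcal A_i\to B(\mathcal H_i)$ be $*$-representations such that $$\varphi_i(a)=\langle \pi_i(a)\xi_i,\xi_i\rangle,\qquad \psi_i(a)=\langle \sigma_i(a)\xi_i,\xi_i\rangle\qquad(a\in\mathcal A_i),$$ as given by the GNS construction for $\varphi_i$ and $\psi_i$ after the two cyclic vectors have been identified; $\xi_i$ need not be cyclic for $\pi_i$ or for $\sigma_i$. (Beyond these identities nothing is required of the linear functionals $\varphi_i,\psi_i$; in particular positivity follows from them.) Put $\mathcal H_i^\circ=\mathcal H_i\ominus\mathbb C\xi_i$, let $$\mathcal H=\mathbb C\xi\oplus\bigoplus_{n\ge1}\ \bigoplus_{i_1>\dots>i_n}\mathcal H_{i_1}^\circ\otimes\dots\otimes\mathcal H_{i_n}^\circ ,\qquad \|\xi\|=1,$$ be the monotone Fock space (Hilbert space direct sums and tensor products), and for $k\in I$ let $\mathcal H(<k)$ be the subspace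 of $\mathcal H$ spanned by $\xi$ and the summands with $i_1<k$. Let $V_k:\mathcal H\to\mathcal H_k\otimes\mathcal H(<k)$ be the partial isometry with $V_k\xi=\xi_k\otimes\xi$ and $$V_k(f_1\otimes\dots\otimes f_n)=\begin{cases}0,& i_1>k,\\ f_1\otimes(f_2\otimes\dots\otimes f_n),& i_1=k,\\ \xi_k\otimes (f_1\otimes\dots\otimes f_n),& i_1<k,\end{cases}\qquad f_1\otimes\dots\otimes f_n\in \mathcal H_{i_1}^\circ\otimes\dots\otimes\mathcal H_{i_n}^\circ$$ (for $n=1$ and $i_1=k$ the value is $f_1\otimes\xi$). For $T\in B(\mathcal H_k)$ let $\omega_k(T)=V_k^*(T\otimes\mathrm{Id})V_k$. Let $P_k$ be the orthogonal projection of $\mathcal H$ onto $\mathbb C\xi\oplus\mathcal H_k^\circ$ and $P_k^\perp=1-P_k$. For $a\in\mathcal A_k$ let $$j_k(a)=\omega_k(\pi_k(a))P_k+\omega_k(\sigma_k(a))P_k^\perp ,$$ and let $\Phi(T)=\langle T\xi,\xi\rangle$ for $T\in B(\mathcal H)$. Then every $j_k:\mathcal A_k\to B(\mathcal H)$ is a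 $*$-representation, $\Phi\circ j_k=\varphi_k$, and whenever $a_k\in\mathcal A_{i_k}$ $(1\le k\le n)$ with $i_k\ne i_{k+1}$ $(1\le k<n)$: (i) if $n\ge2$ and $i_1>i_2$, then $\Phi\big(j_{i_1}(a_1)\cdots j_{i_n}(a_n)\big)=\varphi_{i_1}(a_1)\,\Phi\big(j_{i_2}(a_2)\cdots j_{i_n}(a_n)\big)$; (ii) if $n\ge2$ and $i_n>i_{n-1}$, then $\Phi\big(j_{i_1}(a_1)\cdots j_{i_n}(a_n)\big)=\Phi\big(j_{i_1}(a_1)\cdots j_{i_{n-1}}(a_{n-1})\big)\,\varphi_{i_n}(a_n)$; (iii) if $1<l<n$ and $i_{l-1}<i_l>i_{l+1}$, then $$\begin{aligned}\Phi\big(j_{i_1}(a_1)\cdots j_{i_n}(a_n)\big)={}&\Phi\big(j_{i_1}(a_1)\cdots j_{i_{l-1}}(a_{l-1})\,\psi_{i_l}(a_l)\,j_{i_{l+1}}(a_{l+1})\cdots j_{i_n}(a_n)\big)\\&+\Phi\big(j_{i_1}(a_1)\cdots j_{i_{l-1}}(a_{l-1})\big)\,\big[\varphi_{i_l}(a_l)-\psi_{i_l}(a_l)\big]\,\Phi\big(j_{i_{l+1}}(a_{l+1})\cdots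 j_{i_n}(a_n)\big).\end{aligned}$$ -/

import Mathlib

open scoped TensorProduct

namespace MonotoneFock

universe u v w

/-! ### Hilbert spaces and their tensor products -/

/-- A complex Hilbert space, bundled (used to define tensor products over words by recursion). -/
structure HilbertObj : Type (w + 1) where
  carrier : Type w
  [normed : NormedAddCommGroup carrier]
  [innerSpace : InnerProductSpace ℂ carrier]
  [complete : CompleteSpace carrier]

attribute [instance] HilbertObj.normed HilbertObj.innerSpace HilbertObj.complete

noncomputable section

section Tensor

variable {E E' F F' : Type*}
  [NormedAddCommGroup E] [InnerProductSpace ℂ E] [NormedAddCommGroup E'] [InnerProductSpace ℂ E']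
  [NormedAddCommGroup F] [InnerProductSpace ℂ F] [NormedAddCommGroup F'] [InnerProductSpace ℂ F']

/-- The Hilbert space tensor product: the completion of the algebraic tensor product with respect
to `⟪x ⊗ y, x' ⊗ y'⟫ = ⟪x, x'⟫ * ⟪y, y'⟫`. -/
abbrev HTensor (E F : Type*) [NormedAddCommGroup E] [InnerProductSpace ℂ E]
    [NormedAddCommGroup F] [InnerProductSpace ℂ F] :=
  UniformSpace.Completion (E ⊗[ℂ] F)

/-- The elementary tensor `x ⊗ y` in the Hilbert space tensor product. -/
def htmul (x : E) (y : F) : HTensor E F := ((x ⊗ₜ[ℂ] y : E ⊗[ℂ] F) : HTensor E F)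

/-- The bounded operator `S ⊗ T` on Hilbert space tensor products. -/
def hmap (S : E →L[ℂ] E') (T : F →L[ℂ] F') : HTensor E F →L[ℂ] HTensor E' F' :=
  (UniformSpace.Completion.toComplL.comp (TensorProduct.mapL S T)).extend
    (UniformSpace.Completion.toComplL (𝕜 := ℂ) (E := E ⊗[ℂ] F))

theorem hmap_coe (S : E →L[ℂ] E') (T : F →L[ℂ] F') (x : E ⊗[ℂ] F) :
    hmap S T (x : HTensor E F) = ((TensorProduct.mapL S T x : E' ⊗[ℂ] F') : HTensor E' F') :=
  ContinuousLinearMap.extend_eq _ UniformSpace.Completion.denseRange_coe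
    (UniformSpace.Completion.isUniformInducing_coe _) x

theorem hmap_htmul (S : E →L[ℂ] E') (T : F →L[ℂ] F') (x : E) (y : F) :
    hmap S T (htmul x y) = htmul (S x) (T y) := by
  simp [htmul, hmap_coe]

/-- The isometry `S ⊗ T`, for isometries `S` and `T`. -/
def hmapIsometry (S : E →ₗᵢ[ℂ] E') (T : F →ₗᵢ[ℂ] F') : HTensor E F →ₗᵢ[ℂ] HTensor E' F' where
  toLinearMap := (hmap S.toContinuousLinearMap T.toContinuousLinearMap).toLinearMap
  norm_map' x := by
    induction x using UniformSpace.Completion.induction_on with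
    | hp =>
      exact isClosed_eq
        (hmap S.toContinuousLinearMap T.toContinuousLinearMap).continuous.norm continuous_norm
    | ih x =>
      change ‖hmap S.toContinuousLinearMap T.toContinuousLinearMap (x : HTensor E F)‖ = _
      rw [hmap_coe, UniformSpace.Completion.norm_coe, UniformSpace.Completion.norm_coe,
        TensorProduct.mapL_apply]
      exact TensorProduct.norm_map S T x

theorem hmapIsometry_apply (S : E →ₗᵢ[ℂ] E') (T : F →ₗᵢ[ℂ] F') (x : HTensor E F) :
    hmapIsometry S T x = hmap S.toContinuousLinearMap T.toContinuousLinearMap x := rfl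

/-- The isometry `y ↦ e ⊗ y`, for a unit vector `e`. -/
def leftUnit (e : E) (he : ‖e‖ = 1) : F →ₗᵢ[ℂ] HTensor E F where
  toLinearMap := (UniformSpace.Completion.toComplL (𝕜 := ℂ) (E := E ⊗[ℂ] F)).toLinearMap ∘ₗ
    TensorProduct.mk ℂ E F e
  norm_map' y := by simp [he]

theorem leftUnit_apply (e : E) (he : ‖e‖ = 1) (y : F) : leftUnit e he y = htmul e y := rfl

end Tensor

/-! ### The monotone Fock space -/

section Fock

variable {I : Type u} [LinearOrder I] (H : I → Type w)
  [∀ i, NormedAddCommGroup (H i)] [∀ i, InnerProductSpace ℂ (H i)]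
  (ξ : ∀ i, H i)

/-- `H_i° = H_i ⊖ ℂ ξ_i`. -/
abbrev reduced (i : I) : Submodule ℂ (H i) := (Submodule.span ℂ {ξ i})ᗮ

/-- `H_{i₁}° ⊗ ⋯ ⊗ H_{iₙ}°` for the word `[i₁, …, iₙ]`; the empty word gives a copy of `ℂ`. -/
def wordObj : List I → HilbertObj.{w}
  | [] => ⟨EuclideanSpace ℂ PUnit.{w + 1}⟩
  | i :: s => ⟨HTensor (reduced H ξ i) (wordObj s).carrier⟩

/-- The Hilbert space `H_{i₁}° ⊗ ⋯ ⊗ H_{iₙ}°`. -/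
abbrev WordSpace (s : List I) : Type w := (wordObj H ξ s).carrier

/-- The strictly decreasing words `i₁ > ⋯ > iₙ` (with `n = 0` allowed), all of whose letters
satisfy `p`. For `p = (· ≤ k)` or `p = (· < k)` this only says `i₁ ≤ k` or `i₁ < k`. -/
abbrev Words (p : I → Prop) : Type u := {s : List I // s.Pairwise (· > ·) ∧ ∀ i ∈ s, p i}

/-- The Hilbert space direct sum of the spaces `H_{i₁}° ⊗ ⋯ ⊗ H_{iₙ}°` over `Words p`. -/
abbrev FockOn (p : I → Prop) := lp (fun s : Words p => WordSpace H ξ s.1) 2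

/-- The monotone Fock space, i.e. the monotone product of the Hilbert spaces `H_i`. -/
abbrev Fock := FockOn H ξ (fun _ : I => True)

/-- The space `H(k)`: words with `i₁ ≤ k`. -/
abbrev FockLE (k : I) := FockOn H ξ (· ≤ k)

/-- The space `H(k - 1)`: words with `i₁ < k`. -/
abbrev FockLT (k : I) := FockOn H ξ (· < k)

/-- The inclusion of a summand. -/
def incl (p : I → Prop) (s : Words p) : WordSpace H ξ s.1 →ₗᵢ[ℂ] FockOn H ξ p where
  toLinearMap := lp.lsingle (E := fun s : Words p => WordSpace H ξ s.1) 2 s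
  norm_map' x :=
    lp.norm_single (E := fun s : Words p => WordSpace H ξ s.1) (p := 2) two_pos s x

/-- The empty word. -/
def emptyWord (p : I → Prop) : Words p := ⟨[], by simp⟩

/-- The vacuum vector `ξ`. -/
def vacuum (p : I → Prop) : FockOn H ξ p :=
  incl H ξ p (emptyWord p) (EuclideanSpace.single PUnit.unit (1 : ℂ))

/-- The orthogonal projection of the Fock space onto `H(k)`, as a map into `H(k)`: it forgets the
components at the words with `i₁ > k`. -/
def restrict (k : I) : Fock H ξ →L[ℂ] FockLE H ξ k :=
  let r : Words (I := I) (· ≤ k) → Words (fun _ : I => True) := fun s => ⟨s.1, s.2.1, by simp⟩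
  have hr : Function.Injective r := fun s t h =>
    Subtype.ext (congrArg (fun z : Words (fun _ : I => True) => z.1) h)
  have key : ∀ (f : Fock H ξ) (S : Finset (Words (I := I) (· ≤ k))),
      ∑ s ∈ S, ‖f (r s)‖ ^ (2 : ENNReal).toReal ≤ ‖f‖ ^ (2 : ENNReal).toReal := fun f S => by
    have h := lp.sum_rpow_le_norm_rpow (p := 2) (by simp) f (S.map ⟨r, hr⟩)
    rw [Finset.sum_map] at h
    exact h
  LinearMap.mkContinuous
    { toFun := fun f => ⟨fun s => f (r s), memℓp_gen' (key f)⟩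
      map_add' := fun _ _ => rfl
      map_smul' := fun _ _ => rfl } 1
    (fun f => by
      rw [one_mul]
      exact lp.norm_le_of_forall_sum_le (by simp) (norm_nonneg f) (key f))

theorem restrict_apply (k : I) (f : Fock H ξ) (s : Words (I := I) (· ≤ k)) :
    restrict H ξ k f s = f ⟨s.1, s.2.1, by simp⟩ := rfl

variable (hξ : ∀ i, ‖ξ i‖ = 1)

/-- For a word `[i, i₂, …]`, the map
`f₁ ⊗ f₂ ⊗ ⋯ ↦ f₁ ⊗ (f₂ ⊗ ⋯)` from `H_i° ⊗ H_{i₂}° ⊗ ⋯` to `H_i ⊗ H(i - 1)`. -/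
def headPiece (i : I) (t : List I) (ht : t.Pairwise (· > ·) ∧ ∀ j ∈ t, j < i) :
    WordSpace H ξ (i :: t) →ₗᵢ[ℂ] HTensor (H i) (FockLT H ξ i) :=
  hmapIsometry (reduced H ξ i).subtypeₗᵢ (incl H ξ (· < i) ⟨t, ht⟩)

/-- For a word `s` with letters `< k`, the map `x ↦ ξ_k ⊗ x` into `H_k ⊗ H(k - 1)`. -/
def tailPiece (k : I) (s : Words (I := I) (· < k)) :
    WordSpace H ξ s.1 →ₗᵢ[ℂ] HTensor (H k) (FockLT H ξ k) :=
  (leftUnit (ξ k) (hξ k)).comp (incl H ξ (· < k) s)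

theorem lt_of_cons {k i : I} {t : List I} (h : (i :: t).Pairwise (· > ·) ∧ ∀ j ∈ i :: t, j ≤ k)
    (hi : i ≠ k) : (i :: t).Pairwise (· > ·) ∧ ∀ j ∈ i :: t, j < k :=
  have hik : i < k := lt_of_le_of_ne (h.2 i (by simp)) hi
  ⟨h.1, fun j hj => by
    rcases List.mem_cons.1 hj with rfl | hj
    · exact hik
    · exact lt_trans ((List.pairwise_cons.1 h.1).1 j hj) hik⟩

/-- The restriction of `V_k` to the summand of `H(k)` at a word with `i₁ ≤ k`. -/
def vPiece (k : I) : (s : Words (I := I) (· ≤ k)) →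
    WordSpace H ξ s.1 →ₗᵢ[ℂ] HTensor (H k) (FockLT H ξ k)
  | ⟨[], _⟩ => tailPiece H ξ hξ k (emptyWord _)
  | ⟨i :: t, h⟩ =>
    if hi : i = k then by
      subst hi
      exact headPiece H ξ i t ⟨(List.pairwise_cons.1 h.1).2, (List.pairwise_cons.1 h.1).1⟩
    else tailPiece H ξ hξ k ⟨i :: t, lt_of_cons h hi⟩

theorem vPiece_head (k : I) (t : List I) (h : (k :: t).Pairwise (· > ·) ∧ ∀ j ∈ k :: t, j ≤ k) :
    vPiece H ξ hξ k ⟨k :: t, h⟩ =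
      headPiece H ξ k t ⟨(List.pairwise_cons.1 h.1).2, (List.pairwise_cons.1 h.1).1⟩ := by
  simp [vPiece]

theorem vPiece_tail (k : I) (s : Words (I := I) (· < k)) :
    vPiece H ξ hξ k ⟨s.1, s.2.1, fun j hj => (s.2.2 j hj).le⟩ = tailPiece H ξ hξ k s := by
  obtain ⟨_ | ⟨i, t⟩, h⟩ := s
  · rfl
  · have : i ≠ k := (h.2 i (by simp)).ne
    simp [vPiece, this]

theorem words_le_cases (k : I) (s : Words (I := I) (· ≤ k)) :
    (∃ s' : Words (I := I) (· < k), s = ⟨s'.1, s'.2.1, fun j hj => (s'.2.2 j hj).le⟩) ∨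
      ∃ (t : List I) (h : (k :: t).Pairwise (· > ·) ∧ ∀ j ∈ k :: t, j ≤ k), s = ⟨k :: t, h⟩ := by
  obtain ⟨_ | ⟨i, t⟩, h⟩ := s
  · exact Or.inl ⟨emptyWord _, rfl⟩
  · by_cases hi : i = k
    · subst hi
      exact Or.inr ⟨t, h, rfl⟩
    · exact Or.inl ⟨⟨i :: t, lt_of_cons h hi⟩, rfl⟩

theorem inner_incl (p : I → Prop) {s t : Words p} (h : s ≠ t) (x : WordSpace H ξ s.1)
    (y : WordSpace H ξ t.1) : inner ℂ (incl H ξ p s x) (incl H ξ p t y) = 0 := by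
  have := lp.inner_single_left (𝕜 := ℂ) (G := fun s : Words p => WordSpace H ξ s.1) s x
    (incl H ξ p t y)
  refine this.trans ?_
  have h0 : (incl H ξ p t y) s = 0 :=
    lp.single_apply_ne (E := fun s : Words p => WordSpace H ξ s.1) 2 t y h
  rw [h0, inner_zero_right]

theorem inner_hmapIsometry {E E' F F' : Type*}
    [NormedAddCommGroup E] [InnerProductSpace ℂ E] [NormedAddCommGroup E'] [InnerProductSpace ℂ E']
    [NormedAddCommGroup F] [InnerProductSpace ℂ F] [NormedAddCommGroup F'] [InnerProductSpace ℂ F']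
    (S : E →ₗᵢ[ℂ] E') (T : F →ₗᵢ[ℂ] F') (z : HTensor E' F')
    (h : ∀ x y, inner ℂ (htmul (S x) (T y)) z = 0) (x : HTensor E F) :
    inner ℂ (hmapIsometry S T x) z = 0 := by
  induction x using UniformSpace.Completion.induction_on with
  | hp =>
    exact isClosed_eq ((hmapIsometry S T).continuous.inner continuous_const) continuous_const
  | ih x =>
    induction x using TensorProduct.induction_on with
    | zero => rw [UniformSpace.Completion.coe_zero, map_zero, inner_zero_left]
    | tmul x y =>
      have := h x y
      rw [← LinearIsometry.coe_toContinuousLinearMap, ← LinearIsometry.coe_toContinuousLinearMap T,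
        ← hmap_htmul] at this
      exact this
    | add x y hx hy => rw [UniformSpace.Completion.coe_add, map_add, inner_add_left, hx, hy, zero_add]

theorem inner_htmul {E F : Type*} [NormedAddCommGroup E] [InnerProductSpace ℂ E]
    [NormedAddCommGroup F] [InnerProductSpace ℂ F] (x x' : E) (y y' : F) :
    inner ℂ (htmul x y) (htmul x' y') = inner ℂ x x' * inner ℂ y y' := by
  simp [htmul]

theorem vPiece_orthogonal (k : I) :
    OrthogonalFamily ℂ (fun s : Words (I := I) (· ≤ k) => WordSpace H ξ s.1)
      (vPiece H ξ hξ k) := by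
  have head_tail : ∀ (t : List I) (ht : t.Pairwise (· > ·) ∧ ∀ j ∈ t, j < k)
      (s : Words (I := I) (· < k)) x y,
      inner ℂ (headPiece H ξ k t ht x) (tailPiece H ξ hξ k s y) = 0 := fun t ht s x y => by
    refine inner_hmapIsometry (reduced H ξ k).subtypeₗᵢ (incl H ξ (· < k) ⟨t, ht⟩) _
      (fun a b => ?_) x
    change inner ℂ (htmul ((reduced H ξ k).subtypeₗᵢ a) (incl H ξ (· < k) ⟨t, ht⟩ b))
      (htmul (ξ k) (incl H ξ (· < k) s y)) = 0
    have : inner ℂ (a : H k) (ξ k) = 0 :=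
      (Submodule.mem_orthogonal' _ _).1 a.2 _ (Submodule.mem_span_singleton_self _)
    rw [inner_htmul, Submodule.coe_subtypeₗᵢ, Submodule.subtype_apply, this, zero_mul]
  intro s t hst x y
  rcases words_le_cases k s with ⟨s', rfl⟩ | ⟨s', hs, rfl⟩ <;>
    rcases words_le_cases k t with ⟨t', rfl⟩ | ⟨t', ht, rfl⟩
  · rw [vPiece_tail, vPiece_tail]
    change inner ℂ (htmul (ξ k) (incl H ξ (· < k) s' x)) (htmul (ξ k) (incl H ξ (· < k) t' y)) = 0
    rw [inner_htmul, inner_incl, mul_zero]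
    rintro rfl
    exact hst rfl
  · rw [vPiece_tail, vPiece_head, ← inner_conj_symm, head_tail, map_zero]
  · rw [vPiece_tail, vPiece_head, head_tail]
  · rw [vPiece_head, vPiece_head]
    refine inner_hmapIsometry _ _ _ (fun a b => ?_) x
    rw [← inner_conj_symm]
    refine (congrArg _ (inner_hmapIsometry _ _ _ (fun c d => ?_) y)).trans (map_zero _)
    rw [inner_htmul, inner_incl, mul_zero]
    intro h
    apply hst
    have : t' = s' := congrArg Subtype.val h
    subst this
    rfl

/-- The partial isometry `V_k : H → H_k ⊗ H(k - 1)`: it sends `ξ` to `ξ_k ⊗ ξ` and, on the summand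
at a word `i₁ > ⋯ > iₙ`, it sends `f₁ ⊗ ⋯ ⊗ fₙ` to `0` if `i₁ > k`, to itself if `i₁ = k`, and to
`ξ_k ⊗ f₁ ⊗ ⋯ ⊗ fₙ` if `i₁ < k`. -/
def V (k : I) : Fock H ξ →L[ℂ] HTensor (H k) (FockLT H ξ k) :=
  (vPiece_orthogonal H ξ hξ k).linearIsometry.toContinuousLinearMap ∘L restrict H ξ k

/-- `ω_k(T) = V_k^* (T ⊗ Id) V_k`. -/
def omega (k : I) (T : H k →L[ℂ] H k) : Fock H ξ →L[ℂ] Fock H ξ :=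
  ContinuousLinearMap.adjoint (V H ξ hξ k) ∘L
    hmap T (ContinuousLinearMap.id ℂ (FockLT H ξ k)) ∘L V H ξ hξ k

/-- The subspace `ℂ ξ ⊕ H_k°` of the Fock space: the vectors whose only non-zero components are at
the words `[]` and `[k]`. -/
def vacuumPlus (k : I) : Submodule ℂ (Fock H ξ) where
  carrier := {f | ∀ s : Words (fun _ : I => True), s.1 ≠ [] → s.1 ≠ [k] → f s = 0}
  add_mem' {f g} hf hg s h h' := by
    rw [lp.coeFn_add, Pi.add_apply, hf s h h', hg s h h', add_zero]
  zero_mem' _ _ _ := rfl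
  smul_mem' c f hf s h h' := by
    rw [lp.coeFn_smul, Pi.smul_apply, hf s h h', smul_zero]

theorem isClosed_vacuumPlus (k : I) : IsClosed (vacuumPlus H ξ k : Set (Fock H ξ)) := by
  have : (vacuumPlus H ξ k : Set (Fock H ξ)) =
      ⋂ (s : Words (fun _ : I => True)) (_ : s.1 ≠ []) (_ : s.1 ≠ [k]), {f | f s = 0} := by
    ext f
    simp [vacuumPlus]
  rw [this]
  refine isClosed_iInter fun s => isClosed_iInter fun _ => isClosed_iInter fun _ => ?_
  exact isClosed_eq
    (lp.evalCLM ℂ (fun s : Words (fun _ : I => True) => WordSpace H ξ s.1) 2 s).continuous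
    continuous_const

instance (k : I) : CompleteSpace (vacuumPlus H ξ k) :=
  (isClosed_vacuumPlus H ξ k).completeSpace_coe

/-- `P_k`, the orthogonal projection of the Fock space onto `ℂ ξ ⊕ H_k°`. -/
def proj (k : I) : Fock H ξ →L[ℂ] Fock H ξ := (vacuumPlus H ξ k).starProjection

/-- The vacuum state `Φ(T) = ⟨T ξ, ξ⟩` on the bounded operators of the Fock space (the inner product
of Mathlib is conjugate-linear in its first argument). -/
def vacuumState (T : Fock H ξ →L[ℂ] Fock H ξ) : ℂ :=
  inner ℂ (vacuum H ξ (fun _ => True)) (T (vacuum H ξ (fun _ => True)))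

end Fock

/-! ### The representations -/

/-- A Hilbert space `H` with a unit vector `ξ` and two *-representations `π`, `σ` of a *-algebra `A`
by bounded operators on `H` that give the states `φ` and `ψ` as `φ a = ⟨π a ξ, ξ⟩` and
`ψ a = ⟨σ a ξ, ξ⟩`. The vector `ξ` need not be cyclic for `π` or for `σ`. -/
structure RepPair {A : Type v} [NonUnitalRing A] [StarRing A] [Module ℂ A]
    (φ ψ : A →ₗ[ℂ] ℂ) (H : Type w)
    [NormedAddCommGroup H] [InnerProductSpace ℂ H] [CompleteSpace H] where
  ξ : H
  norm_ξ : ‖ξ‖ = 1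
  π : A →⋆ₙₐ[ℂ] (H →L[ℂ] H)
  σ : A →⋆ₙₐ[ℂ] (H →L[ℂ] H)
  inner_π : ∀ a, φ a = inner ℂ ξ (π a ξ)
  inner_σ : ∀ a, ψ a = inner ℂ ξ (σ a ξ)

section Rep

variable {I : Type u} [LinearOrder I] {A : I → Type v}
  [∀ i, NonUnitalRing (A i)] [∀ i, StarRing (A i)] [∀ i, Module ℂ (A i)]
  {H : I → Type w}
  [∀ i, NormedAddCommGroup (H i)] [∀ i, InnerProductSpace ℂ (H i)] [∀ i, CompleteSpace (H i)]
  {φ ψ : ∀ i, A i →ₗ[ℂ] ℂ} (ρ : ∀ i, RepPair (φ i) (ψ i) (H i))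

/-- The monotone Fock space of the family `(H_i, ξ_i)`. -/
abbrev FockSpace := Fock H (fun i => (ρ i).ξ)

/-- `j_k(a) = ω_k(π_k(a)) P_k + ω_k(σ_k(a)) P_k^⊥`. -/
def j (k : I) (a : A k) : FockSpace ρ →L[ℂ] FockSpace ρ :=
  omega H (fun i => (ρ i).ξ) (fun i => (ρ i).norm_ξ) k ((ρ k).π a) ∘L
      proj H (fun i => (ρ i).ξ) k +
    omega H (fun i => (ρ i).ξ) (fun i => (ρ i).norm_ξ) k ((ρ k).σ a) ∘L
      (1 - proj H (fun i => (ρ i).ξ) k)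

/-- The vacuum state `Φ` on the bounded operators of the monotone Fock space. -/
def Φ (T : FockSpace ρ →L[ℂ] FockSpace ρ) : ℂ := vacuumState H (fun i => (ρ i).ξ) T

/-- The product `j_{i₁}(a₁) ⋯ j_{iₙ}(aₙ)` for a word `(i₁, a₁), …, (iₙ, aₙ)`. -/
def jprod (x : List (Σ i, A i)) : FockSpace ρ →L[ℂ] FockSpace ρ :=
  (x.map fun y => j ρ y.1 y.2).prod

end Rep

end

end MonotoneFock

/-!
The operator `V_k` is a coisometry (`V_comp_adjoint`): along `H_k = ℂ ξ_k ⊕ H_k°`, the subspace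
`ξ_k ⊗ H(<k)` is the image of the words with letters `< k`, and `H_k° ⊗ H(<k)` is the image of the
words beginning with `k`. Hence `ω_k` is a *-homomorphism. Under `V_k` the subspace `ℂ ξ ⊕ H_k°`
corresponds to `H_k ⊗ ξ`, so it is invariant under every `ω_k(T)`; as the operators `ω_k(T)` are
closed under adjoints, the projection `P_k` commutes with them (`commute_omega_proj`). So `j_k` is a
sum of two *-representations cut down by complementary commuting projections, hence a
*-representation.

All the formulas for the vacuum state come from one computation, `j_sub_mem`: for `f` supported on
the words with letters `< k`,
`j_k(a) f = ψ_k(a) f + (φ_k(a) - ψ_k(a)) ⟨f, ξ⟩ ξ + r`, where `r` is supported on the words that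
begin with `k`. Indeed `P_k` fixes `ξ` and kills the other words below `k`, and `ω_k(T)` multiplies
such a word by `⟨T ξ_k, ξ_k⟩` up to words beginning with `k`. The remainder `r` is orthogonal to `ξ`
and is killed by `j_i(b)` for every `i < k` (`j_eq_zero`). Since the range of `j_i(b)` is supported
on the words with letters `≤ i` (`j_mem`), the computation applies to the vector obtained by
applying to `ξ` the factors to the right of a peak `k`: a peak at the left end is `inner_vacuum_j`,
and a peak with a left neighbour is `j_j_apply`, with `f = ξ` if the peak is at the right end.
-/

namespace MonotoneFock

universe u v w

/-! ### Operators on Hilbert space tensor products -/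

section Tensor

variable {E F : Type*} [NormedAddCommGroup E] [InnerProductSpace ℂ E]
  [NormedAddCommGroup F] [InnerProductSpace ℂ F]

theorem htmul_add_left (x x' : E) (y : F) : htmul (x + x') y = htmul x y + htmul x' y := by
  simp only [htmul, TensorProduct.add_tmul, UniformSpace.Completion.coe_add]

theorem htmul_smul_left (c : ℂ) (x : E) (y : F) : htmul (c • x) y = c • htmul x y := by
  simp only [htmul, ← TensorProduct.smul_tmul', UniformSpace.Completion.coe_smul]

theorem htmul_zero_left (y : F) : htmul (0 : E) y = 0 := by
  simp [htmul]

/-- The continuous linear map `y ↦ x ⊗ y`. -/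
noncomputable def htmulLeft (x : E) : F →L[ℂ] HTensor E F :=
  LinearMap.mkContinuous
    ((UniformSpace.Completion.toComplL (𝕜 := ℂ) (E := E ⊗[ℂ] F)).toLinearMap ∘ₗ
      TensorProduct.mk ℂ E F x) ‖x‖ (fun y => by simp)

/-- Elementary tensors are total in the Hilbert space tensor product. -/
@[elab_as_elim]
theorem htensor_induction {P : HTensor E F → Prop} (z : HTensor E F)
    (closed : IsClosed {z | P z}) (add : ∀ z z', P z → P z' → P (z + z'))
    (tmul : ∀ x y, P (htmul x y)) : P z := by
  induction z using UniformSpace.Completion.induction_on with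
  | hp => exact closed
  | ih z =>
    induction z using TensorProduct.induction_on with
    | zero =>
      have := tmul 0 0
      rwa [htmul_zero_left] at this
    | tmul x y => exact tmul x y
    | add x y hx hy =>
      rw [UniformSpace.Completion.coe_add]
      exact add _ _ hx hy

theorem htensor_ext {G : Type*} [NormedAddCommGroup G] [NormedSpace ℂ G]
    {S T : HTensor E F →L[ℂ] G} (h : ∀ x y, S (htmul x y) = T (htmul x y)) : S = T := by
  ext1 z
  induction z using htensor_induction with
  | closed => exact isClosed_eq S.continuous T.continuous
  | add z z' hz hz' => rw [map_add, map_add, hz, hz']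
  | tmul x y => exact h x y

theorem map_htmul_smul_add {G : Type*} [NormedAddCommGroup G] [NormedSpace ℂ G]
    (T : HTensor E F →L[ℂ] G) (c : ℂ) (x x' : E) (y : F) :
    T (htmul (c • x + x') y) = c • T (htmul x y) + T (htmul x' y) := by
  rw [htmul_add_left, htmul_smul_left, map_add, map_smul]

theorem hmap_add_left (S S' : E →L[ℂ] E) (T : F →L[ℂ] F) :
    hmap (S + S') T = hmap S T + hmap S' T :=
  htensor_ext fun x y => by
    simp only [add_apply, hmap_htmul, htmul_add_left]

theorem hmap_smul_left (c : ℂ) (S : E →L[ℂ] E) (T : F →L[ℂ] F) :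
    hmap (c • S) T = c • hmap S T :=
  htensor_ext fun x y => by
    simp only [smul_apply, hmap_htmul, htmul_smul_left]

theorem hmap_comp_id (S S' : E →L[ℂ] E) :
    hmap (S ∘L S') (ContinuousLinearMap.id ℂ F) =
      hmap S (ContinuousLinearMap.id ℂ F) ∘L hmap S' (ContinuousLinearMap.id ℂ F) :=
  htensor_ext fun x y => by
    simp only [ContinuousLinearMap.comp_apply, hmap_htmul, ContinuousLinearMap.id_apply]

theorem adjoint_hmap_id [CompleteSpace E] (S : E →L[ℂ] E) :
    ContinuousLinearMap.adjoint (hmap S (ContinuousLinearMap.id ℂ F)) =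
      hmap (ContinuousLinearMap.adjoint S) (ContinuousLinearMap.id ℂ F) := by
  symm
  rw [ContinuousLinearMap.eq_adjoint_iff]
  intro z z'
  induction z using htensor_induction with
  | closed =>
    exact isClosed_eq (by fun_prop) (by fun_prop)
  | add z w hz hw => rw [map_add, inner_add_left, inner_add_left, hz, hw]
  | tmul x y =>
    induction z' using htensor_induction with
    | closed => exact isClosed_eq (by fun_prop) (by fun_prop)
    | add z w hz hw => rw [map_add, inner_add_right, inner_add_right, hz, hw]
    | tmul x' y' =>
      rw [hmap_htmul, hmap_htmul, inner_htmul, inner_htmul,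
        ContinuousLinearMap.adjoint_inner_left]
      rfl

/-- Splitting `h = ⟨e, h⟩ e + f` along `E = ℂ e ⊕ (E ⊖ ℂ e)`, for a unit vector `e`. -/
theorem exists_eq_smul_add_orthogonal {e : E} (he : ‖e‖ = 1) (h : E) :
    ∃ f : (Submodule.span ℂ {e})ᗮ, h = (inner ℂ e h : ℂ) • e + (f : E) := by
  refine ⟨⟨h - (inner ℂ e h : ℂ) • e, ?_⟩, by simp⟩
  rw [Submodule.mem_orthogonal_singleton_iff_inner_right, inner_sub_right, inner_smul_right,
    inner_self_eq_norm_sq_to_K, he]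
  simp

end Tensor

section Fock

variable {I : Type u} [LinearOrder I] (H : I → Type w)
  [∀ i, NormedAddCommGroup (H i)] [∀ i, InnerProductSpace ℂ (H i)]
  (ξ : ∀ i, H i)

/-! ### Vectors of the Fock space with prescribed support -/

/-- The vectors whose components vanish at every word outside `Q`. -/
def supportedOn (p : I → Prop) (Q : Words p → Prop) : Submodule ℂ (FockOn H ξ p) where
  carrier := {f | ∀ s, ¬ Q s → f s = 0}
  add_mem' {f g} hf hg s h := by
    rw [lp.coeFn_add, Pi.add_apply, hf s h, hg s h, add_zero]
  zero_mem' _ _ := rfl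
  smul_mem' c f hf s h := by
    rw [lp.coeFn_smul, Pi.smul_apply, hf s h, smul_zero]

theorem isClosed_supportedOn (p : I → Prop) (Q : Words p → Prop) :
    IsClosed (supportedOn H ξ p Q : Set (FockOn H ξ p)) := by
  have : (supportedOn H ξ p Q : Set (FockOn H ξ p)) =
      ⋂ (s : Words p) (_ : ¬ Q s), {f | f s = 0} := by
    ext f
    simp [supportedOn]
  rw [this]
  refine isClosed_iInter fun s => isClosed_iInter fun _ => ?_
  exact isClosed_eq (lp.evalCLM ℂ (fun s : Words p => WordSpace H ξ s.1) 2 s).continuous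
    continuous_const

theorem incl_apply_self (p : I → Prop) (s : Words p) (x : WordSpace H ξ s.1) :
    incl H ξ p s x s = x :=
  lp.single_apply_self (E := fun s : Words p => WordSpace H ξ s.1) 2 s x

theorem incl_apply_ne (p : I → Prop) {s t : Words p} (h : t ≠ s) (x : WordSpace H ξ s.1) :
    incl H ξ p s x t = 0 :=
  lp.single_apply_ne (E := fun s : Words p => WordSpace H ξ s.1) 2 s x h

theorem incl_mem_supportedOn (p : I → Prop) {Q : Words p → Prop} {s : Words p} (hs : Q s)
    (x : WordSpace H ξ s.1) : incl H ξ p s x ∈ supportedOn H ξ p Q := fun t ht =>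
  incl_apply_ne H ξ p (by rintro rfl; exact ht hs) x

theorem inner_incl_left (p : I → Prop) (s : Words p) (x : WordSpace H ξ s.1) (f : FockOn H ξ p) :
    inner ℂ (incl H ξ p s x) f = inner ℂ x (f s) :=
  lp.inner_single_left (𝕜 := ℂ) (G := fun s : Words p => WordSpace H ξ s.1) s x f

/-- The vectors concentrated at a single word of `Q` are total among those supported on `Q`. -/
theorem mem_of_mem_supportedOn (p : I → Prop) {Q : Words p → Prop} {S : Submodule ℂ (FockOn H ξ p)}
    (hS : IsClosed (S : Set (FockOn H ξ p))) (h : ∀ s, Q s → ∀ x, incl H ξ p s x ∈ S)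
    {f : FockOn H ξ p} (hf : f ∈ supportedOn H ξ p Q) : f ∈ S := by
  have hsum : HasSum (fun s => incl H ξ p s (f s)) f :=
    lp.hasSum_single (E := fun s : Words p => WordSpace H ξ s.1) (p := 2) (by simp) f
  refine hS.mem_of_tendsto hsum (Filter.Eventually.of_forall fun F => S.sum_mem fun s _ => ?_)
  by_cases hs : Q s
  · exact h s hs _
  · rw [hf s hs, map_zero]
    exact S.zero_mem

theorem mem_of_forall_incl_mem (p : I → Prop) {S : Submodule ℂ (FockOn H ξ p)}
    (hS : IsClosed (S : Set (FockOn H ξ p))) (h : ∀ s x, incl H ξ p s x ∈ S)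
    (f : FockOn H ξ p) : f ∈ S :=
  mem_of_mem_supportedOn H ξ p (Q := fun _ => True) hS (fun s _ => h s)
    (fun _ hs => absurd trivial hs)

theorem fock_ext (p : I → Prop) {G : Type*} [NormedAddCommGroup G] [NormedSpace ℂ G]
    {S T : FockOn H ξ p →L[ℂ] G} (h : ∀ s x, S (incl H ξ p s x) = T (incl H ξ p s x)) : S = T := by
  ext1 f
  exact mem_of_forall_incl_mem H ξ p (S := LinearMap.eqLocus S.toLinearMap T.toLinearMap)
    (isClosed_eq S.continuous T.continuous) h f

theorem vacuumPlus_eq_supportedOn (k : I) :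
    vacuumPlus H ξ k = supportedOn H ξ _ (fun s => s.1 = [] ∨ s.1 = [k]) := by
  ext f
  simp [vacuumPlus, supportedOn]

/-- A word with letters in `p`, as a word without restriction on its letters. -/
abbrev toWord {p : I → Prop} (s : Words p) : Words (fun _ : I => True) := ⟨s.1, s.2.1, by simp⟩

/-- The word `k, i₁, …, iₙ` for a word `i₁ > ⋯ > iₙ` with letters `< k`. -/
abbrev consWord (k : I) (s : Words (I := I) (· < k)) : Words (I := I) (fun _ : I => True) :=
  ⟨k :: s.1, List.pairwise_cons.2 ⟨s.2.2, s.2.1⟩, by simp⟩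

/-- The inclusion of the summand `H_k° ⊗ (H_{i₁}° ⊗ ⋯ ⊗ H_{iₙ}°)` for a word `i₁ > ⋯ > iₙ` with
letters `< k`; this is `incl` at the word `k, i₁, …, iₙ`, with its domain displayed as a tensor
product. -/
noncomputable def inclCons (k : I) (s : Words (I := I) (· < k)) :
    HTensor (reduced H ξ k) (WordSpace H ξ s.1) →ₗᵢ[ℂ] Fock H ξ :=
  incl H ξ _ (consWord k s)

theorem inclCons_mem_supportedOn (k : I) (s : Words (I := I) (· < k))
    {Q : Words (fun _ : I => True) → Prop} (hs : Q (consWord k s)) (x) :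
    inclCons H ξ k s x ∈ supportedOn H ξ _ Q :=
  incl_mem_supportedOn H ξ _ hs x

/-! ### The partial isometry `V_k` is a coisometry -/

variable (hξ : ∀ i, ‖ξ i‖ = 1)

theorem V_incl (k : I) (s : Words (I := I) (· ≤ k)) (x : WordSpace H ξ s.1) :
    V H ξ hξ k (incl H ξ _ (toWord s) x) = vPiece H ξ hξ k s x := by
  have hr : restrict H ξ k (incl H ξ _ (toWord s) x) = incl H ξ (· ≤ k) s x := by
    refine lp.ext (funext fun t => ?_)
    rw [restrict_apply]
    by_cases h : t = s
    · subst h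
      exact (incl_apply_self H ξ _ (toWord t) x).trans (incl_apply_self H ξ _ t x).symm
    · have h' : toWord t ≠ toWord s := fun h' => h (Subtype.ext (congrArg (fun z => z.1) h'))
      exact (incl_apply_ne H ξ _ h' x).trans (incl_apply_ne H ξ _ h x).symm
  change (vPiece_orthogonal H ξ hξ k).linearIsometry (restrict H ξ k _) = _
  rw [hr]
  exact (vPiece_orthogonal H ξ hξ k).linearIsometry_apply_single x

theorem adjoint_V_vPiece (k : I) (s : Words (I := I) (· ≤ k)) (x : WordSpace H ξ s.1) :
    ContinuousLinearMap.adjoint (V H ξ hξ k) (vPiece H ξ hξ k s x) =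
      incl H ξ _ (toWord s) x := by
  refine ext_inner_right ℂ fun f => ?_
  rw [ContinuousLinearMap.adjoint_inner_left, inner_incl_left H ξ _ (toWord s),
    ← (vPiece_orthogonal H ξ hξ k).linearIsometry_apply_single x]
  change inner ℂ ((vPiece_orthogonal H ξ hξ k).linearIsometry _)
    ((vPiece_orthogonal H ξ hξ k).linearIsometry (restrict H ξ k f)) = _
  rw [LinearIsometry.inner_map_map]
  exact inner_incl_left H ξ (· ≤ k) s x (restrict H ξ k f)

/-- `V_k (g₁ ⊗ ⋯ ⊗ gₙ) = ξ_k ⊗ (g₁ ⊗ ⋯ ⊗ gₙ)` at the words with letters `< k`. -/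
theorem V_incl_lt (k : I) (s : Words (I := I) (· < k)) (x : WordSpace H ξ s.1) :
    V H ξ hξ k (incl H ξ _ (toWord s) x) = htmul (ξ k) (incl H ξ _ s x) := by
  have h := V_incl H ξ hξ k ⟨s.1, s.2.1, fun j hj => (s.2.2 j hj).le⟩ x
  rwa [vPiece_tail] at h

theorem adjoint_V_htmul_unit (k : I) (s : Words (I := I) (· < k)) (x : WordSpace H ξ s.1) :
    ContinuousLinearMap.adjoint (V H ξ hξ k) (htmul (ξ k) (incl H ξ _ s x)) =
      incl H ξ _ (toWord s) x := by
  have h := adjoint_V_vPiece H ξ hξ k ⟨s.1, s.2.1, fun j hj => (s.2.2 j hj).le⟩ x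
  rwa [vPiece_tail] at h

theorem V_incl_cons (k : I) (s : Words (I := I) (· < k)) (f : reduced H ξ k)
    (x : WordSpace H ξ s.1) :
    V H ξ hξ k (inclCons H ξ k s (htmul f x)) = htmul (f : H k) (incl H ξ _ s x) := by
  have h := V_incl H ξ hξ k ⟨k :: s.1, (consWord k s).2.1, by
    simpa using fun j hj => (s.2.2 j hj).le⟩ (htmul f x)
  rw [vPiece_head] at h
  exact h.trans (hmap_htmul _ _ _ _)

theorem adjoint_V_htmul_reduced (k : I) (s : Words (I := I) (· < k)) (f : reduced H ξ k)
    (x : WordSpace H ξ s.1) :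
    ContinuousLinearMap.adjoint (V H ξ hξ k) (htmul (f : H k) (incl H ξ _ s x)) =
      inclCons H ξ k s (htmul f x) := by
  have h := adjoint_V_vPiece H ξ hξ k ⟨k :: s.1, (consWord k s).2.1, by
    simpa using fun j hj => (s.2.2 j hj).le⟩ (htmul f x)
  rw [vPiece_head] at h
  refine Eq.trans (congrArg (ContinuousLinearMap.adjoint (V H ξ hξ k)) ?_) h
  exact (hmap_htmul (reduced H ξ k).subtypeₗᵢ.toContinuousLinearMap
    (incl H ξ (· < k) s).toContinuousLinearMap f x).symm

theorem V_eq_zero (k : I) {f : Fock H ξ} (hf : ∀ s : Words (I := I) (· ≤ k), f (toWord s) = 0) :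
    V H ξ hξ k f = 0 := by
  have : restrict H ξ k f = 0 := lp.ext (funext fun s => hf s)
  change (vPiece_orthogonal H ξ hξ k).linearIsometry (restrict H ξ k f) = 0
  rw [this, map_zero]

/-- The range of `V_k^*` is supported on the words with letters `≤ k`: the others are killed by
`V_k`. -/
theorem adjoint_V_mem (k : I) (z : HTensor (H k) (FockLT H ξ k)) :
    ContinuousLinearMap.adjoint (V H ξ hξ k) z ∈
      supportedOn H ξ _ (fun s => ∀ i ∈ s.1, i ≤ k) := by
  intro s hs
  refine ext_inner_left ℂ fun x => ?_
  rw [← inner_incl_left, ContinuousLinearMap.adjoint_inner_right, V_eq_zero, inner_zero_left,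
    inner_zero_right]
  intro t
  refine incl_apply_ne H ξ (fun _ => True) (s := s) (fun h => hs ?_) x
  rw [← h]
  exact t.2.2

theorem adjoint_V_htmul (k : I) (s : Words (I := I) (· < k)) (h : H k) (x : WordSpace H ξ s.1) :
    ∃ f : reduced H ξ k, h = (inner ℂ (ξ k) h : ℂ) • ξ k + (f : H k) ∧
      ContinuousLinearMap.adjoint (V H ξ hξ k) (htmul h (incl H ξ _ s x)) =
        (inner ℂ (ξ k) h : ℂ) • incl H ξ _ (toWord s) x + inclCons H ξ k s (htmul f x) := by
  obtain ⟨f, hf⟩ := exists_eq_smul_add_orthogonal (hξ k) h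
  refine ⟨f, hf, ?_⟩
  conv_lhs => rw [hf]
  rw [map_htmul_smul_add, adjoint_V_htmul_unit, adjoint_V_htmul_reduced]

theorem V_adjoint_V_htmul (k : I) (s : Words (I := I) (· < k)) (h : H k) (x : WordSpace H ξ s.1) :
    V H ξ hξ k (ContinuousLinearMap.adjoint (V H ξ hξ k) (htmul h (incl H ξ _ s x))) =
      htmul h (incl H ξ _ s x) := by
  obtain ⟨f, hf, hV⟩ := adjoint_V_htmul H ξ hξ k s h x
  refine (congrArg (V H ξ hξ k) hV).trans ?_
  rw [map_add, map_smul, V_incl_lt, V_incl_cons, ← htmul_smul_left, ← htmul_add_left, ← hf]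

/-- `V_k` is onto: `ξ_k ⊗ H(<k)` is the image of `H(<k)`, and `H_k° ⊗ H(<k)` that of the words
beginning with `k`. -/
theorem V_comp_adjoint (k : I) :
    V H ξ hξ k ∘L ContinuousLinearMap.adjoint (V H ξ hξ k) = ContinuousLinearMap.id ℂ _ := by
  refine htensor_ext fun h g => ?_
  refine DFunLike.congr_fun (fock_ext H ξ (· < k)
    (S := (V H ξ hξ k ∘L ContinuousLinearMap.adjoint (V H ξ hξ k)) ∘L htmulLeft h)
    (T := htmulLeft h) fun s x => ?_) g
  exact V_adjoint_V_htmul H ξ hξ k s h x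

/-! ### The *-homomorphism `ω_k` and the projection `P_k` -/

theorem omega_add (k : I) (S T : H k →L[ℂ] H k) :
    omega H ξ hξ k (S + T) = omega H ξ hξ k S + omega H ξ hξ k T := by
  ext1 f
  simp [omega, hmap_add_left]

theorem omega_smul (k : I) (c : ℂ) (T : H k →L[ℂ] H k) :
    omega H ξ hξ k (c • T) = c • omega H ξ hξ k T := by
  ext1 f
  simp [omega, hmap_smul_left]

/-- `ω_k` is multiplicative because `V_k V_k^* = 1`. -/
theorem omega_mul (k : I) (S T : H k →L[ℂ] H k) :
    omega H ξ hξ k (S * T) = omega H ξ hξ k S * omega H ξ hξ k T := by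
  ext1 f
  have h := fun z => DFunLike.congr_fun (V_comp_adjoint H ξ hξ k) z
  simp only [ContinuousLinearMap.comp_apply, ContinuousLinearMap.id_apply] at h
  simp [omega, ContinuousLinearMap.mul_def, hmap_comp_id, h]

theorem star_omega [∀ i, CompleteSpace (H i)] (k : I) (T : H k →L[ℂ] H k) :
    star (omega H ξ hξ k T) = omega H ξ hξ k (star T) := by
  simp [omega, ContinuousLinearMap.star_eq_adjoint, ContinuousLinearMap.adjoint_comp,
    adjoint_hmap_id, ContinuousLinearMap.comp_assoc]

theorem omega_apply_of_V_eq (k : I) (T : H k →L[ℂ] H k) {f : Fock H ξ} {h : H k}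
    {g : FockLT H ξ k} (hf : V H ξ hξ k f = htmul h g) :
    omega H ξ hξ k T f = ContinuousLinearMap.adjoint (V H ξ hξ k) (htmul (T h) g) :=
  congrArg (ContinuousLinearMap.adjoint (V H ξ hξ k)) <|
    (congrArg (hmap T (ContinuousLinearMap.id ℂ _)) hf).trans (hmap_htmul _ _ _ _)

/-- `ω_k(T)` leaves `ℂ ξ ⊕ H_k°` invariant, since `V_k` identifies that subspace with
`H_k ⊗ ξ`. -/
theorem omega_mem_vacuumPlus (k : I) (T : H k →L[ℂ] H k) {f : Fock H ξ}
    (hf : f ∈ vacuumPlus H ξ k) : omega H ξ hξ k T f ∈ vacuumPlus H ξ k := by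
  have key : ∀ (h : H k) (x : WordSpace H ξ (emptyWord (· < k)).1),
      ContinuousLinearMap.adjoint (V H ξ hξ k)
        (htmul h (incl H ξ _ (emptyWord (· < k)) x)) ∈ vacuumPlus H ξ k := fun h x => by
    obtain ⟨_, -, hV⟩ := adjoint_V_htmul H ξ hξ k (emptyWord _) h x
    rw [hV, vacuumPlus_eq_supportedOn]
    exact Submodule.add_mem _ (Submodule.smul_mem _ _ (incl_mem_supportedOn H ξ _ (Or.inl rfl) _))
      (inclCons_mem_supportedOn H ξ k _ (Or.inr rfl) _)
  have hcl : IsClosed ((vacuumPlus H ξ k).comap (omega H ξ hξ k T).toLinearMap : Set (Fock H ξ)) :=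
    (isClosed_vacuumPlus H ξ k).preimage (omega H ξ hξ k T).continuous
  rw [vacuumPlus_eq_supportedOn] at hf
  refine mem_of_mem_supportedOn H ξ _ hcl (fun s hs x => ?_) hf
  obtain ⟨s, hs'⟩ := s
  change omega H ξ hξ k T _ ∈ vacuumPlus H ξ k
  rcases hs with rfl | rfl
  · exact Eq.mpr (congrArg (· ∈ vacuumPlus H ξ k)
      (omega_apply_of_V_eq H ξ hξ k T (V_incl_lt H ξ hξ k (emptyWord _) x))) (key _ _)
  · -- The summand at `[k]` is `H_k° ⊗ ℂ`, by definition of `WordSpace`.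
    change HTensor (reduced H ξ k) (WordSpace H ξ (emptyWord (I := I) (· < k)).1) at x
    change omega H ξ hξ k T (inclCons H ξ k (emptyWord (· < k)) x) ∈ vacuumPlus H ξ k
    induction x using htensor_induction with
    | closed => exact hcl.preimage (inclCons H ξ k (emptyWord (· < k))).continuous
    | add z z' hz hz' =>
      rw [map_add, map_add]
      exact Submodule.add_mem _ hz hz'
    | tmul f y =>
      exact Eq.mpr (congrArg (· ∈ vacuumPlus H ξ k)
        (omega_apply_of_V_eq H ξ hξ k T (V_incl_cons H ξ hξ k (emptyWord _) f y))) (key _ _)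

theorem star_proj (k : I) : star (proj H ξ k) = proj H ξ k :=
  isSelfAdjoint_starProjection (vacuumPlus H ξ k)

theorem proj_mul_self (k : I) : proj H ξ k * proj H ξ k = proj H ξ k :=
  (vacuumPlus H ξ k).isIdempotentElem_starProjection

/-- Invariance of the range of `P_k` under `ω_k(T)` and under `ω_k(T)^* = ω_k(T^*)` gives
commutation. -/
theorem commute_omega_proj [∀ i, CompleteSpace (H i)] (k : I) (T : H k →L[ℂ] H k) :
    omega H ξ hξ k T * proj H ξ k = proj H ξ k * omega H ξ hξ k T := by
  have h : ∀ T, proj H ξ k * (omega H ξ hξ k T * proj H ξ k) = omega H ξ hξ k T * proj H ξ k := by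
    intro T
    ext1 f
    exact Submodule.starProjection_eq_self_iff.2
      (omega_mem_vacuumPlus H ξ hξ k T (Submodule.starProjection_apply_mem _ _))
  have h' := congrArg star (h (star T))
  simp only [star_mul, star_omega, star_proj, star_star] at h'
  rw [← h T, ← h', mul_assoc]

theorem proj_eq_zero (k : I) {f : Fock H ξ}
    (hf : f ∈ supportedOn H ξ _ (fun s => s.1 ≠ [] ∧ s.1 ≠ [k])) : proj H ξ k f = 0 := by
  refine (Submodule.starProjection_apply_eq_zero_iff _).2 ?_
  rw [Submodule.mem_orthogonal]
  intro g hg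
  rw [lp.inner_eq_tsum]
  refine (tsum_congr fun s => ?_).trans tsum_zero
  by_cases hs : s.1 ≠ [] ∧ s.1 ≠ [k]
  · rw [hg s hs.1 hs.2, inner_zero_left]
  · rw [hf s hs, inner_zero_right]

theorem proj_vacuum (k : I) : proj H ξ k (vacuum H ξ _) = vacuum H ξ _ := by
  refine Submodule.starProjection_eq_self_iff.2 ?_
  rw [vacuumPlus_eq_supportedOn]
  exact incl_mem_supportedOn H ξ _ (Or.inl rfl) _

theorem norm_vacuum (p : I → Prop) : ‖vacuum H ξ p‖ = 1 := by
  refine ((incl H ξ p (emptyWord p)).norm_map _).trans ?_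
  exact (PiLp.norm_single _ _ _ _).trans norm_one

theorem inner_vacuum_self :
    inner ℂ (vacuum H ξ (fun _ => True)) (vacuum H ξ (fun _ => True)) = (1 : ℂ) := by
  rw [inner_self_eq_norm_sq_to_K, norm_vacuum]
  simp

theorem inner_vacuum_eq_zero (f : Fock H ξ) (hf : f (emptyWord _) = 0) :
    inner ℂ (vacuum H ξ _) f = 0 := by
  refine (inner_incl_left H ξ _ (emptyWord _) _ f).trans ?_
  exact (congrArg _ hf).trans (inner_zero_right _)

theorem incl_empty (x : WordSpace H ξ (emptyWord (fun _ : I => True)).1) :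
    ∃ c : ℂ, incl H ξ _ (emptyWord _) x = c • vacuum H ξ _ := by
  change EuclideanSpace ℂ PUnit at x
  have hx : x = x PUnit.unit • EuclideanSpace.single PUnit.unit (1 : ℂ) := by
    ext i
    simp
  exact ⟨x PUnit.unit, (congrArg (incl H ξ _ (emptyWord _)) hx).trans
    (map_smul (incl H ξ _ (emptyWord _)) _ _)⟩

/-- The value of `ω_k(T)` at the words with letters `< k`: the component along `ξ_k` gives back the
word, the component in `H_k°` lengthens it by the letter `k`. -/
theorem omega_incl_lt (k : I) (T : H k →L[ℂ] H k) (s : Words (I := I) (· < k))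
    (x : WordSpace H ξ s.1) :
    ∃ y, omega H ξ hξ k T (incl H ξ _ (toWord s) x) =
      (inner ℂ (ξ k) (T (ξ k)) : ℂ) • incl H ξ _ (toWord s) x + inclCons H ξ k s y := by
  obtain ⟨f, -, hV⟩ := adjoint_V_htmul H ξ hξ k s (T (ξ k)) x
  refine ⟨htmul f x, ?_⟩
  rw [← hV]
  exact omega_apply_of_V_eq H ξ hξ k T (V_incl_lt H ξ hξ k s x)

end Fock

section Rep

variable {I : Type u} [LinearOrder I] {A : I → Type v}
  [∀ i, NonUnitalRing (A i)] [∀ i, StarRing (A i)] [∀ i, Module ℂ (A i)]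
  {H : I → Type w}
  [∀ i, NormedAddCommGroup (H i)] [∀ i, InnerProductSpace ℂ (H i)] [∀ i, CompleteSpace (H i)]
  {φ ψ : ∀ i, A i →ₗ[ℂ] ℂ} (ρ : ∀ i, RepPair (φ i) (ψ i) (H i))

/-! ### The representations `j_k` -/

theorem j_apply (k : I) (a : A k) (f : FockSpace ρ) :
    j ρ k a f =
      omega H (fun i => (ρ i).ξ) (fun i => (ρ i).norm_ξ) k ((ρ k).π a) (proj H _ k f) +
        omega H (fun i => (ρ i).ξ) (fun i => (ρ i).norm_ξ) k ((ρ k).σ a) (f - proj H _ k f) :=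
  rfl

/-- `j_k` is multiplicative because `P_k` commutes with `ω_k`. -/
theorem j_mul (k : I) (a b : A k) : j ρ k (a * b) = j ρ k a * j ρ k b := by
  have hP := proj_mul_self H (fun i => (ρ i).ξ) k
  have hπ := commute_omega_proj H (fun i => (ρ i).ξ) (fun i => (ρ i).norm_ξ) k ((ρ k).π b)
  have hσ := commute_omega_proj H (fun i => (ρ i).ξ) (fun i => (ρ i).norm_ξ) k ((ρ k).σ b)
  simp only [j, map_mul, omega_mul, ← ContinuousLinearMap.mul_def]
  -- What remains is a computation in the ring of operators, with `P² = P`, `YP = PY`, `WP = PW`.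
  generalize omega H (fun i => (ρ i).ξ) (fun i => (ρ i).norm_ξ) k ((ρ k).π a) = X at *
  generalize omega H (fun i => (ρ i).ξ) (fun i => (ρ i).norm_ξ) k ((ρ k).π b) = Y at *
  generalize omega H (fun i => (ρ i).ξ) (fun i => (ρ i).norm_ξ) k ((ρ k).σ a) = Z at *
  generalize omega H (fun i => (ρ i).ξ) (fun i => (ρ i).norm_ξ) k ((ρ k).σ b) = W at *
  generalize proj H (fun i => (ρ i).ξ) k = P at *
  have h1 : P * (Y * P) = Y * P := by rw [hπ, ← mul_assoc, hP]
  have h2 : P * (W * P) = W * P := by rw [hσ, ← mul_assoc, hP]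
  simp only [mul_add, add_mul, mul_sub, sub_mul, mul_one, mul_assoc, h1, h2, ← hσ]
  abel

theorem star_j (k : I) (a : A k) : star (j ρ k a) = j ρ k (star a) := by
  simp only [j, ← ContinuousLinearMap.mul_def, star_add, star_mul, star_sub, star_proj,
    star_omega, map_star, mul_sub, commute_omega_proj, mul_one]

theorem j_add (k : I) (a b : A k) : j ρ k (a + b) = j ρ k a + j ρ k b := by
  ext1 f
  simp only [j_apply, map_add, omega_add, add_apply]
  abel

theorem j_smul (k : I) (c : ℂ) (a : A k) : j ρ k (c • a) = c • j ρ k a := by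
  ext1 f
  simp only [j_apply, map_smul, omega_smul, smul_apply, smul_add]

/-- `j_k` as a *-homomorphism. -/
noncomputable def jHom (k : I) : A k →⋆ₙₐ[ℂ] (FockSpace ρ →L[ℂ] FockSpace ρ) where
  toFun := j ρ k
  map_smul' := j_smul ρ k
  map_zero' := by simpa using j_smul ρ k 0 0
  map_add' := j_add ρ k
  map_mul' := j_mul ρ k
  map_star' a := (star_j ρ k a).symm

/-! ### The action of `j_k` on words with letters below `k` -/

/-- The range of `j_k(a)` is supported on the words with letters `≤ k`. -/
theorem j_mem (k : I) (a : A k) (f : FockSpace ρ) :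
    j ρ k a f ∈ supportedOn H (fun i => (ρ i).ξ) _ (fun s => ∀ i ∈ s.1, i ≤ k) :=
  Submodule.add_mem _ (adjoint_V_mem H _ _ k _) (adjoint_V_mem H _ _ k _)

/-- `j_i(a)` kills the words that begin with a letter `k > i`. -/
theorem j_eq_zero {i k : I} (hik : i < k) (a : A i) {f : FockSpace ρ}
    (hf : f ∈ supportedOn H (fun i => (ρ i).ξ) _ (fun s => s.1.head? = some k)) :
    j ρ i a f = 0 := by
  have hP : proj H (fun i => (ρ i).ξ) i f = 0 := by
    refine proj_eq_zero H _ i fun s hs => hf s fun h => hs ⟨?_, ?_⟩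
    · intro h'
      simp [h'] at h
    · intro h'
      simp [h', hik.ne] at h
  have hV : V H (fun i => (ρ i).ξ) (fun i => (ρ i).norm_ξ) i f = 0 :=
    V_eq_zero H _ _ i fun s => hf _ fun h =>
      absurd (s.2.2 k (List.mem_of_mem_head? h)) hik.not_ge
  rw [j_apply, hP, map_zero, zero_add, sub_zero, omega, ContinuousLinearMap.comp_apply,
    ContinuousLinearMap.comp_apply, hV, map_zero, map_zero]

/-- On vectors supported below `k`, up to words that begin with `k`, the operator `j_k(a)` is
`φ_k(a)` on the vacuum and `ψ_k(a)` on its orthogonal complement. -/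
theorem j_sub_mem (k : I) (a : A k) {f : FockSpace ρ}
    (hf : f ∈ supportedOn H (fun i => (ρ i).ξ) _ (fun s => ∀ i ∈ s.1, i < k)) :
    j ρ k a f - (ψ k a • f + ((φ k a - ψ k a) * inner ℂ (vacuum H _ _) f) • vacuum H _ _) ∈
      supportedOn H (fun i => (ρ i).ξ) _ (fun s => s.1.head? = some k) := by
  -- The difference is a bounded linear function `R` of `f`, so it suffices to treat single words.
  let R : FockSpace ρ →L[ℂ] FockSpace ρ := j ρ k a - (ψ k a • ContinuousLinearMap.id ℂ _ +
    (φ k a - ψ k a) • (innerSL ℂ (vacuum H (fun i => (ρ i).ξ) _)).smulRight (vacuum H _ _))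
  have hR : ∀ f, R f = j ρ k a f -
      (ψ k a • f + ((φ k a - ψ k a) * inner ℂ (vacuum H _ _) f) • vacuum H _ _) := fun f => by
    simp [R, mul_smul]
  rw [← hR]
  have hcl := (isClosed_supportedOn H (fun i => (ρ i).ξ) _ (fun s => s.1.head? = some k)).preimage
    R.continuous
  refine mem_of_mem_supportedOn H _ _ (S := Submodule.comap R.toLinearMap
    (supportedOn H (fun i => (ρ i).ξ) _ (fun s => s.1.head? = some k))) hcl
    (fun s hs x => ?_) hf
  change R _ ∈ supportedOn H (fun i => (ρ i).ξ) _ (fun s => s.1.head? = some k)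
  -- At the empty word `P_k` is the identity and `π_k` acts; at the others `P_k` vanishes and `σ_k`
  -- acts.
  by_cases hs0 : s.1 = []
  · obtain rfl : s = emptyWord _ := Subtype.ext hs0
    obtain ⟨c, hc⟩ := incl_empty H (fun i => (ρ i).ξ) x
    rw [hc, map_smul]
    refine Submodule.smul_mem _ _ ?_
    obtain ⟨y, hy⟩ := omega_incl_lt H _ (fun i => (ρ i).norm_ξ) k ((ρ k).π a) (emptyWord _)
      (EuclideanSpace.single PUnit.unit (1 : ℂ))
    change omega H _ _ k _ (vacuum H (fun i => (ρ i).ξ) (fun _ => True)) =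
      _ • vacuum H (fun i => (ρ i).ξ) (fun _ => True) + _ at hy
    rw [hR, j_apply, proj_vacuum, sub_self, map_zero, add_zero, hy, ← (ρ k).inner_π,
      inner_vacuum_self, mul_one, ← add_smul, add_sub_cancel, add_sub_cancel_left]
    exact inclCons_mem_supportedOn H _ k _ (Q := fun s => s.1.head? = some k) rfl _
  · have hP : proj H (fun i => (ρ i).ξ) k (incl H _ _ s x) = 0 := by
      refine proj_eq_zero H _ k (incl_mem_supportedOn H _ _ ⟨hs0, fun h => ?_⟩ _)
      exact lt_irrefl k (hs k (by simp [h]))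
    have hv : inner ℂ (vacuum H (fun i => (ρ i).ξ) _) (incl H _ _ s x) = (0 : ℂ) :=
      inner_vacuum_eq_zero H _ _ (incl_apply_ne H _ _ (fun h => hs0 (by rw [← h]; rfl)) x)
    obtain ⟨y, hy⟩ := omega_incl_lt H _ (fun i => (ρ i).norm_ξ) k ((ρ k).σ a) ⟨s.1, s.2.1, hs⟩ x
    change omega H _ _ k _ (incl H (fun i => (ρ i).ξ) (fun _ => True) s x) =
      _ • incl H (fun i => (ρ i).ξ) (fun _ => True) s x + _ at hy
    rw [hR, j_apply, hP, map_zero, zero_add, sub_zero, hy, ← (ρ k).inner_σ, hv, mul_zero, zero_smul,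
      add_zero, add_sub_cancel_left]
    exact inclCons_mem_supportedOn H _ k _ (Q := fun s => s.1.head? = some k) rfl _

theorem Φ_eq (T : FockSpace ρ →L[ℂ] FockSpace ρ) :
    Φ ρ T = inner ℂ (vacuum H (fun i => (ρ i).ξ) _) (T (vacuum H _ _)) := rfl

/-- Below `k`, the vacuum component of `j_k(a) f` depends only on that of `f`: a peak at the left end
of a product factors out. -/
theorem inner_vacuum_j (k : I) (a : A k) {f : FockSpace ρ}
    (hf : f ∈ supportedOn H (fun i => (ρ i).ξ) _ (fun s => ∀ i ∈ s.1, i < k)) :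
    inner ℂ (vacuum H (fun i => (ρ i).ξ) _) (j ρ k a f) =
      φ k a * inner ℂ (vacuum H (fun i => (ρ i).ξ) _) f := by
  have h := inner_vacuum_eq_zero H _ _ (j_sub_mem ρ k a hf (emptyWord _) (by simp [emptyWord]))
  rw [inner_sub_right, inner_add_right, inner_smul_right, inner_smul_right, inner_vacuum_self,
    sub_eq_zero] at h
  rw [h]
  ring

/-- A peak `k > i` inside a product: the part of `j_k(a) f` at words beginning with `k` is killed by
`j_i(b)`, and what is left is a combination of `f` and the vacuum. -/
theorem j_j_apply {i k : I} (hik : i < k) (b : A i) (a : A k) {f : FockSpace ρ}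
    (hf : f ∈ supportedOn H (fun i => (ρ i).ξ) _ (fun s => ∀ i ∈ s.1, i < k)) :
    j ρ i b (j ρ k a f) = ψ k a • j ρ i b f +
      ((φ k a - ψ k a) * inner ℂ (vacuum H (fun i => (ρ i).ξ) _) f) • j ρ i b (vacuum H _ _) := by
  have h := j_eq_zero ρ hik b (j_sub_mem ρ k a hf)
  rwa [map_sub, map_add, map_smul, map_smul, sub_eq_zero] at h

theorem vacuum_mem (k : I) : vacuum H (fun i => (ρ i).ξ) (fun _ => True) ∈
    supportedOn H (fun i => (ρ i).ξ) _ (fun s => ∀ i ∈ s.1, i < k) :=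
  incl_mem_supportedOn H _ _ (by simp [emptyWord]) _

theorem jprod_cons (x : Σ i, A i) (v : List (Σ i, A i)) :
    jprod ρ (x :: v) = j ρ x.1 x.2 * jprod ρ v := by
  simp [jprod]

theorem jprod_append (u v : List (Σ i, A i)) : jprod ρ (u ++ v) = jprod ρ u * jprod ρ v := by
  simp [jprod]

theorem jprod_cons_apply_mem {k : I} (z : Σ i, A i) (hz : z.1 < k) (v : List (Σ i, A i))
    (f : FockSpace ρ) : jprod ρ (z :: v) f ∈
      supportedOn H (fun i => (ρ i).ξ) _ (fun s => ∀ i ∈ s.1, i < k) := fun s hs => by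
  rw [jprod_cons]
  exact j_mem ρ z.1 z.2 _ s fun h => hs fun i hi => (h i hi).trans_lt hz

end Rep

end MonotoneFock

/-! ### Vacuum expectations of products -/

theorem mainTheorem2 {I : Type*} [LinearOrder I] {A : I → Type*}
    [∀ i, NonUnitalRing (A i)] [∀ i, StarRing (A i)] [∀ i, Module ℂ (A i)]
    [∀ i, IsScalarTower ℂ (A i) (A i)] [∀ i, SMulCommClass ℂ (A i) (A i)]
    [∀ i, StarModule ℂ (A i)]
    {H : I → Type*} [∀ i, NormedAddCommGroup (H i)] [∀ i, InnerProductSpace ℂ (H i)]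
    [∀ i, CompleteSpace (H i)]
    (φ ψ : ∀ i, A i →ₗ[ℂ] ℂ) (ρ : ∀ i, MonotoneFock.RepPair (φ i) (ψ i) (H i)) :
    -- each `j_k` is a *-representation, and `Φ ∘ j_k = φ_k`
    (∀ k, ∃ J : A k →⋆ₙₐ[ℂ] (MonotoneFock.FockSpace ρ →L[ℂ] MonotoneFock.FockSpace ρ),
      ∀ a, J a = MonotoneFock.j ρ k a) ∧
    (∀ k a, MonotoneFock.Φ ρ (MonotoneFock.j ρ k a) = φ k a) ∧
    -- (i)
    (∀ (x y : Σ i, A i) (v : List (Σ i, A i)),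
      (x :: y :: v).IsChain (fun s t => s.1 ≠ t.1) → x.1 > y.1 →
      MonotoneFock.Φ ρ (MonotoneFock.jprod ρ (x :: y :: v)) =
        φ x.1 x.2 * MonotoneFock.Φ ρ (MonotoneFock.jprod ρ (y :: v))) ∧
    -- (ii)
    (∀ (u : List (Σ i, A i)) (x y : Σ i, A i),
      (u ++ [x, y]).IsChain (fun s t => s.1 ≠ t.1) → y.1 > x.1 →
      MonotoneFock.Φ ρ (MonotoneFock.jprod ρ (u ++ [x, y])) =
        MonotoneFock.Φ ρ (MonotoneFock.jprod ρ (u ++ [x])) * φ y.1 y.2) ∧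
    -- (iii)
    (∀ (u : List (Σ i, A i)) (x y z : Σ i, A i) (v : List (Σ i, A i)),
      (u ++ x :: y :: z :: v).IsChain (fun s t => s.1 ≠ t.1) → x.1 < y.1 → y.1 > z.1 →
      MonotoneFock.Φ ρ (MonotoneFock.jprod ρ (u ++ x :: y :: z :: v)) =
        MonotoneFock.Φ ρ (MonotoneFock.jprod ρ (u ++ [x]) * (ψ y.1 y.2 • 1) *
          MonotoneFock.jprod ρ (z :: v)) +
        MonotoneFock.Φ ρ (MonotoneFock.jprod ρ (u ++ [x])) * (φ y.1 y.2 - ψ y.1 y.2) *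
          MonotoneFock.Φ ρ (MonotoneFock.jprod ρ (z :: v))) := by 
  refine ⟨fun k => ⟨MonotoneFock.jHom ρ k, fun _ => rfl⟩, fun k a => ?_, fun x y v _ hxy => ?_,
    fun u x y _ hxy => ?_, fun u x y z v _ hxy hyz => ?_⟩
  · rw [MonotoneFock.Φ_eq, MonotoneFock.inner_vacuum_j ρ k a (MonotoneFock.vacuum_mem ρ k),
      MonotoneFock.inner_vacuum_self, mul_one]
  · rw [MonotoneFock.Φ_eq, MonotoneFock.jprod_cons, mul_apply_eq_comp,
      MonotoneFock.inner_vacuum_j ρ x.1 x.2 (MonotoneFock.jprod_cons_apply_mem ρ y hxy v _)]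
    rfl
  · -- The peak `y` acts on the vacuum itself, where the `ψ`-terms cancel.
    have h := MonotoneFock.j_j_apply ρ hxy x.2 y.2 (MonotoneFock.vacuum_mem ρ y.1)
    rw [MonotoneFock.inner_vacuum_self, mul_one, ← add_smul, add_sub_cancel] at h
    have hu : ∀ w, MonotoneFock.jprod ρ [w] = MonotoneFock.j ρ w.1 w.2 := fun w => by
      simp [MonotoneFock.jprod]
    rw [MonotoneFock.Φ_eq, MonotoneFock.Φ_eq, MonotoneFock.jprod_append, MonotoneFock.jprod_append,
      MonotoneFock.jprod_cons, hu, hu, mul_apply_eq_comp,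
      mul_apply_eq_comp, mul_apply_eq_comp, h, map_smul,
      inner_smul_right, mul_comm]
  · have h := MonotoneFock.j_j_apply ρ hxy x.2 y.2
      (MonotoneFock.jprod_cons_apply_mem ρ z hyz v (MonotoneFock.vacuum _ _ _))
    have hu : MonotoneFock.jprod ρ [x] = MonotoneFock.j ρ x.1 x.2 := by
      simp [MonotoneFock.jprod]
    rw [MonotoneFock.Φ_eq, MonotoneFock.Φ_eq, MonotoneFock.Φ_eq, MonotoneFock.Φ_eq,
      MonotoneFock.jprod_append, MonotoneFock.jprod_append, MonotoneFock.jprod_cons ρ x,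
      MonotoneFock.jprod_cons ρ y, hu]
    simp only [mul_apply_eq_comp, h, smul_apply,
      one_apply_eq_self, map_add, map_smul, inner_add_right, inner_smul_right]
    ring
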